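/- Let $\mathbb S$ be a finite state space, $\mathbb A=\{0,1\}$, and let $G(s,a,s')\ge 0$ ($s'\ne s$) be the rate at which an arm moves from state $s$ to state $s'$ under action $a$; put $G(s,a,s)=-\sum_{s'\neq s}G(s,a,s')$. Assume that $G$ is unichain: for every Markov policy $\pi$ (a stationary randomized policy, $\pi(a\mid s)$ being the probability of action $a$ in state $s$), the continuous-time Markov chain on $\mathbb S$ with transition rates $\sum_{a}\pi(a\mid s)G(s,a,s')$ has exactly one recurrent class. Let $\bar\pi$ be any Markov policy. The leader-and-follower system of $\bar\pi$ is a pair of arms with states $S(t)$ (follower) and $\hat S(t)$ (leader), $t\ge 0$, and a common action $\hat A(t)$. The decision epochs are time $0$ and the points of a Poisson process of rate $\Lambda$, independent of the sequence of states and actions at the successive epochs, where $\Lambda>0$ is any constant that bounds from above the total transition rate of the pair in every state and under every action (e.g. any positive $\Lambda\ge 2\max_{s,a}|G(s,a,s)|$). At each decision epoch the leader draws its action $\hat A$ from $\bar\pi(\cdot\mid\hat S)$, and the follower takes the same action regardless of its own state; between decision epochs states and action are constant. If the states and the action are $(s,\hat s,a)$ after an epoch, then at the next epoch the pair of states moves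 as follows. If $s\neq\hat s$, it goes to $(s',\hat s)$ with probability $G(s,a,s')/\Lambda$ for each $s'\ne s$, to $(s,\hat s')$ with probability $G(\hat s,a,\hat s')/\Lambda$ for each $\hat s'\neq\hat s$, and stays otherwise. If $s=\hat s$, it goes to $(s',s')$ with probability $G(s,a,s')/\Lambda$ for each $s'\ne s$, and stays otherwise. Given initial states $(S(0),\hat S(0))=(s,\hat s)$, let \[ \tau^{\mathrm{sync}}(s,\hat s)=\inf\{t\ge 0:\ S(t)=\hat S(t)\}\in[0,\infty]. \] Then, for all initial states $s,\hat s\in\mathbb S$, $\tau^{\mathrm{sync}}(s,\hat s)$ is (almost surely equal to) a random variable, and \[ \mathbb E\big[\tau^{\mathrm{sync}}(s,\hat s)\big]<\infty . \] -/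

import Mathlib

open MeasureTheory ProbabilityTheory
open scoped NNReal ENNReal

namespace RestlessBandit

/-- Transition rates of a continuous-time single-armed decision process with finite state space `S`
and actions `0, 1`: `rate s a s'` is the rate of moving from `s` to `s' ≠ s` under action `a`.
By `rate_sum` the diagonal entry is `rate s a s = -∑ s' ≠ s, rate s a s'`. -/
structure RateKernel (S : Type*) [Fintype S] where
  rate : S → Fin 2 → S → ℝ
  rate_nonneg : ∀ s a s', s' ≠ s → 0 ≤ rate s a s'
  rate_sum : ∀ s a, ∑ s', rate s a s' = 0

/-- A (stationary, randomized) Markov policy: `π s a` is the probability of action `a` in state `s`. -/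
abbrev Policy (S : Type*) := S → PMF (Fin 2)

namespace RateKernel

variable {S : Type*} [Fintype S]

/-- The total rate of leaving state `s` under action `a`. -/
def exitRate (G : RateKernel S) (s : S) (a : Fin 2) : ℝ := -G.rate s a s

/-- The rates of the continuous-time Markov chain induced by a policy. -/
noncomputable def policyRate (G : RateKernel S) (π : Policy S) (s s' : S) : ℝ :=
  ∑ a, (π s a).toReal * G.rate s a s'

/-- `s'` can be reached from `s` in the chain induced by `π`. -/
def Reaches (G : RateKernel S) (π : Policy S) : S → S → Prop :=
  Relation.ReflTransGen (fun s s' => 0 < G.policyRate π s s')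

/-- A recurrent class of the (finite) chain induced by `π`: a closed communicating class. -/
def IsRecurrentClass (G : RateKernel S) (π : Policy S) (C : Set S) : Prop :=
  C.Nonempty ∧ ∀ s ∈ C, ∀ s', G.Reaches π s s' ↔ s' ∈ C

/-- Under every Markov policy, the induced chain has a single recurrent class. -/
def Unichain (G : RateKernel S) : Prop :=
  ∀ π : Policy S, ∃! C : Set S, G.IsRecurrentClass π C

variable [DecidableEq S]

/-- The rates of the leader-and-follower pair `x = (follower state, leader state)` while the leader
takes action `a`, which the follower copies. If the states differ, the two arms move independently
(so never at the same instant); if they agree, the arms move together.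
The diagonal entry is minus the sum of the other ones. -/
def pairRate (G : RateKernel S) (x : S × S) (a : Fin 2) (y : S × S) : ℝ :=
  if x.1 = x.2 then
    if y.1 = y.2 then G.rate x.1 a y.1 else 0
  else
    (if y.2 = x.2 then G.rate x.1 a y.1 else 0) + (if y.1 = x.1 then G.rate x.2 a y.2 else 0)

/-- The total rate of leaving `x` for the leader-and-follower pair under action `a`. -/
def pairExitRate (G : RateKernel S) (x : S × S) (a : Fin 2) : ℝ := -G.pairRate x a x

/-- `Λ` can serve as a uniformization rate of the leader-and-follower system: it is positive and at
least the total transition rate of the pair in every state and under every action. -/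
structure IsUniformizationRate (G : RateKernel S) (Λ : ℝ) : Prop where
  pos : 0 < Λ
  exit_le : ∀ x a, G.pairExitRate x a ≤ Λ

lemma exitRate_nonneg (G : RateKernel S) (s : S) (a : Fin 2) : 0 ≤ G.exitRate s a := by
  have h := G.rate_sum s a
  rw [← Finset.add_sum_erase _ _ (Finset.mem_univ s)] at h
  have h2 : 0 ≤ ∑ s' ∈ Finset.univ.erase s, G.rate s a s' :=
    Finset.sum_nonneg fun s' hs' => G.rate_nonneg s a s' (Finset.ne_of_mem_erase hs')
  unfold exitRate
  linarith

/-- In particular every positive `Λ ≥ 2 * max exitRate` is a uniformization rate. -/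
lemma isUniformizationRate_of_two_mul_exitRate_le (G : RateKernel S) {Λ : ℝ} (hpos : 0 < Λ)
    (h : ∀ s a, 2 * G.exitRate s a ≤ Λ) : G.IsUniformizationRate Λ := by
  refine ⟨hpos, fun x a => ?_⟩
  have h1 := h x.1 a
  have h2 := h x.2 a
  have h3 := G.exitRate_nonneg x.1 a
  unfold pairExitRate pairRate
  simp only [exitRate] at *
  split_ifs with hx <;> linarith

lemma pairRate_nonneg (G : RateKernel S) (x : S × S) (a : Fin 2) (y : S × S) (hxy : y ≠ x) :
    0 ≤ G.pairRate x a y := by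
  obtain ⟨s, t⟩ := x
  obtain ⟨s', t'⟩ := y
  unfold pairRate
  simp only [ne_eq, Prod.mk.injEq, not_and] at hxy ⊢
  split_ifs with h1 h2 h2 h3 h3
  · exact G.rate_nonneg _ _ _ fun h => hxy h (h2 ▸ h1 ▸ h)
  · exact le_rfl
  · exact absurd h2 (hxy h3)
  · simpa using G.rate_nonneg _ _ _ fun h => hxy h h2
  · simpa using G.rate_nonneg _ _ _ (hxy h3)
  · simp

lemma pairRate_sum (G : RateKernel S) (x : S × S) (a : Fin 2) : ∑ y, G.pairRate x a y = 0 := by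
  unfold pairRate
  rw [Fintype.sum_prod_type]
  split_ifs with h
  · simpa using G.rate_sum x.1 a
  · simp [Finset.sum_add_distrib, G.rate_sum]

/-- One step of the uniformized chain of the pair under action `a`: the transition matrix
`I + pairRate / Λ`. -/
noncomputable def pairStep (G : RateKernel S) {Λ : ℝ} (hΛ : G.IsUniformizationRate Λ)
    (x : S × S) (a : Fin 2) : PMF (S × S) :=
  PMF.ofFintype
    (fun y => ENNReal.ofReal ((if y = x then 1 else 0) + G.pairRate x a y / Λ)) (by
      have hp := hΛ.pos
      rw [← ENNReal.ofReal_sum_of_nonneg]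
      · simp [Finset.sum_add_distrib, ← Finset.sum_div, G.pairRate_sum]
      · intro y _
        split_ifs with h
        · have h1 := hΛ.exit_le x a
          unfold pairExitRate at h1
          rw [h, ← sub_neg_eq_add, ← neg_div, sub_nonneg]
          exact (div_le_one hp).2 h1
        · have := G.pairRate_nonneg x a y h
          positivity)

end RateKernel

variable {S : Type*} [Fintype S] [DecidableEq S]

/-- The configuration of the leader-and-follower system: the state of the follower, the state of the
leader, and the action of the leader, which is also that of the follower. -/
abbrev Config (S : Type*) := (S × S) × Fin 2

namespace Config

/-- The state of the follower. -/
def follower (z : Config S) : S := z.1.1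

/-- The state of the leader. -/
def leader (z : Config S) : S := z.1.2

end Config

/-- Given the states of the two arms, the leader chooses the action by `π` from its own state. -/
noncomputable def chooseAction (π : Policy S) (x : S × S) : PMF (Config S) :=
  (π x.2).map fun a => (x, a)

/-- The transition from one decision epoch to the next: the states move under the current action, and
then the leader chooses a new action. -/
noncomputable def epochStep (G : RateKernel S) {Λ : ℝ} (hΛ : G.IsUniformizationRate Λ)
    (π : Policy S) (z : Config S) : PMF (Config S) :=
  (G.pairStep hΛ z.1 z.2).bind (chooseAction π)

variable [MeasurableSpace S] [MeasurableSingletonClass S]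

/-- `epochStep` as a Markov kernel. -/
noncomputable def epochKernel (G : RateKernel S) {Λ : ℝ} (hΛ : G.IsUniformizationRate Λ)
    (π : Policy S) : Kernel (Config S) (Config S) :=
  Kernel.ofFunOfCountable fun z => (epochStep G hΛ π z).toMeasure

instance (G : RateKernel S) {Λ : ℝ} (hΛ : G.IsUniformizationRate Λ) (π : Policy S) :
    IsMarkovKernel (epochKernel G hΛ π) :=
  ⟨fun z => inferInstanceAs (IsProbabilityMeasure (epochStep G hΛ π z).toMeasure)⟩

/-- The law of the configurations at the successive decision epochs, started from the follower
state `s` and the leader state `s'`: the Markov chain with kernel `epochKernel`. -/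
noncomputable def epochLaw (G : RateKernel S) {Λ : ℝ} (hΛ : G.IsUniformizationRate Λ)
    (π : Policy S) (s s' : S) : Measure (ℕ → Config S) :=
  Kernel.trajMeasure (X := fun _ => Config S) (chooseAction π (s, s')).toMeasure
    (fun n => (epochKernel G hΛ π).comap (fun h => h ⟨n, Finset.mem_Iic.2 le_rfl⟩)
      (measurable_pi_apply _))

/-- Sample points: the configurations at the decision epochs, and the times between these. -/
abbrev Sample (S : Type*) := (ℕ → Config S) × (ℕ → ℝ)

/-- The law of the leader-and-follower system with decision epochs at the points of a Poisson process
of rate `Λ` (i.i.d. exponential times between epochs, independent of the configurations). -/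
noncomputable def leaderFollowerLaw (G : RateKernel S) {Λ : ℝ} (hΛ : G.IsUniformizationRate Λ)
    (π : Policy S) (s s' : S) : Measure (Sample S) :=
  (epochLaw G hΛ π s s').prod (Measure.infinitePi fun _ : ℕ => expMeasure Λ)

/-- The time of the `k`-th decision epoch (epoch `0` is at time `0`). -/
def epochTime (ω : Sample S) (k : ℕ) : ℝ := ∑ j ∈ Finset.range k, ω.2 j

/-- The index of the last decision epoch up to time `t`. -/
noncomputable def epochIndex (ω : Sample S) (t : ℝ≥0) : ℕ := sSup {k | epochTime ω k ≤ t}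

/-- The configuration at time `t`: it is constant between decision epochs. -/
noncomputable def configAt (ω : Sample S) (t : ℝ≥0) : Config S := ω.1 (epochIndex ω t)

/-- The synchronization time: the infimum of the times at which the states of the two arms agree
(`⊤` if there are none). -/
noncomputable def syncTime (ω : Sample S) : ℝ≥0∞ :=
  ⨅ (t : ℝ≥0) (_ : (configAt ω t).follower = (configAt ω t).leader), (t : ℝ≥0∞)

end RestlessBandit

/-! The heart is that the pair can synchronize from every state (`Unichain.exists_pairReaches_eq`).
Suppose that it cannot from `x`. Then the arms never meet: the leader can travel alone to every
state of the recurrent class `C` of `π` while the follower stands still, and the follower can move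
alone under the leader's actions. Fix `c ∈ C`, and let `π'` equal `π` on `C` and play `π c`
elsewhere. Let `F` be the set of follower states that are reachable jointly with every leader state
in `C`. It misses `C`, since otherwise the arms could meet. It is closed under `π'`: with the leader
at `c` the follower can make any move of `π'`, after which the leader can go anywhere in `C`. But
`C` is closed under `π'` too, which contradicts unichain for `π'`.

Finiteness of the state space turns this possibility into geometric tails for the number of epochs
before synchronization (`exists_tsum_killedStep_iterate_le`). The synchronization time adds up the
epoch lengths until then; these are independent of the configurations and have finite mean, so its
expectation is a product of two finite factors. -/

namespace RestlessBandit

/-! ### Recurrent classes and closed sets -/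

/-- From every point of a finite directed graph one reaches a point that can be reached back from
everything it reaches. -/
lemma exists_reflTransGen_recurrent {α : Type*} [Finite α] (r : α → α → Prop) (x : α) :
    ∃ y, Relation.ReflTransGen r x y ∧
      ∀ z, Relation.ReflTransGen r y z → Relation.ReflTransGen r z y := by
  -- Choose `y` so that its set of reachable points is minimal for inclusion.
  obtain ⟨_, ⟨y, hy, rfl⟩, hmin⟩ := (wellFounded_lt (α := Set α)).has_min
    ((fun y => {z | Relation.ReflTransGen r y z}) '' {y | Relation.ReflTransGen r x y})
    ⟨_, x, .refl, rfl⟩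
  refine ⟨y, hy, fun z hz => ?_⟩
  by_contra hzy
  refine hmin _ ⟨z, hy.trans hz, rfl⟩ (Set.ssubset_iff_subset_ne.2 ⟨fun w hw => hz.trans hw, ?_⟩)
  intro h
  have hy' : y ∈ {w | Relation.ReflTransGen r y w} := Relation.ReflTransGen.refl
  exact hzy (h.symm.subset hy')

namespace RateKernel

variable {S : Type*} [Fintype S]

lemma exists_recurrentClass_reachable (G : RateKernel S) (π : Policy S) (s : S) :
    ∃ C, G.IsRecurrentClass π C ∧ ∀ c ∈ C, G.Reaches π s c := by
  obtain ⟨y, hy, h⟩ := exists_reflTransGen_recurrent (fun s s' => 0 < G.policyRate π s s') s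
  exact ⟨{z | G.Reaches π y z}, ⟨⟨y, .refl⟩, fun z hz w =>
    ⟨fun hw => Relation.ReflTransGen.trans hz hw, fun hw => (h z hz).trans hw⟩⟩,
    fun c hc => hy.trans hc⟩

/-- In a unichain model, the recurrent class of a policy is reached from everywhere. -/
lemma Unichain.exists_forall_reaches {G : RateKernel S} (hG : G.Unichain) (π : Policy S) :
    ∃ C, G.IsRecurrentClass π C ∧ ∀ s, ∀ c ∈ C, G.Reaches π s c := by
  obtain ⟨C, hC, huniq⟩ := hG π
  refine ⟨C, hC, fun s c hc => ?_⟩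
  obtain ⟨C', hC', h⟩ := G.exists_recurrentClass_reachable π s
  exact h c (huniq C' hC' ▸ hc)

/-- In a unichain model, two nonempty sets of states that are closed under a policy intersect. -/
lemma Unichain.inter_nonempty {G : RateKernel S} (hG : G.Unichain) (π : Policy S) {A B : Set S}
    (hA : A.Nonempty) (hB : B.Nonempty)
    (hA' : ∀ s ∈ A, ∀ s', 0 < G.policyRate π s s' → s' ∈ A)
    (hB' : ∀ s ∈ B, ∀ s', 0 < G.policyRate π s s' → s' ∈ B) : (A ∩ B).Nonempty := by
  obtain ⟨C, ⟨⟨c, hc⟩, -⟩, h⟩ := hG.exists_forall_reaches π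
  have closed {T : Set S} (hT : ∀ s ∈ T, ∀ s', 0 < G.policyRate π s s' → s' ∈ T) {s s' : S}
      (hs : s ∈ T) (hr : G.Reaches π s s') : s' ∈ T := by
    induction hr with
    | refl => exact hs
    | tail _ h2 ih => exact hT _ ih _ h2
  obtain ⟨a, ha⟩ := hA
  obtain ⟨b, hb⟩ := hB
  exact ⟨c, closed hA' ha (h a c hc), closed hB' hb (h b c hc)⟩

lemma exists_rate_pos_of_policyRate_pos {G : RateKernel S} {π : Policy S} {s s' : S}
    (h : 0 < G.policyRate π s s') : ∃ a, a ∈ (π s).support ∧ 0 < G.rate s a s' := by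
  obtain ⟨a, -, ha⟩ := Finset.exists_lt_of_sum_lt (s := Finset.univ) (f := fun _ => (0 : ℝ))
    (g := fun a => (π s a).toReal * G.rate s a s')
    (by rw [Finset.sum_const_zero]; exact h)
  refine ⟨a, fun h0 => ?_, pos_of_mul_pos_right ha ENNReal.toReal_nonneg⟩
  simp [h0] at ha

variable [DecidableEq S]

/-! ### Reachability of synchronization -/

/-- `y` can be reached from `x` by the leader-and-follower pair. -/
def PairReaches (G : RateKernel S) (π : Policy S) : S × S → S × S → Prop :=
  Relation.ReflTransGen (fun x y => ∃ a ∈ (π x.2).support, 0 < G.pairRate x a y)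

/-- While the arms cannot synchronize, the leader moves as an arm on its own. -/
lemma PairReaches.leader_move {G : RateKernel S} {π : Policy S} {x : S × S} {s t t' : S}
    (hx : ∀ y, G.PairReaches π x y → y.1 ≠ y.2) (h : G.PairReaches π x (s, t))
    (ht : G.Reaches π t t') : G.PairReaches π x (s, t') := by
  induction ht with
  | refl => exact h
  | @tail b c _ h2 ih =>
    by_cases hbc : c = b
    · rwa [hbc]
    obtain ⟨a, ha, hr⟩ := exists_rate_pos_of_policyRate_pos h2
    refine Relation.ReflTransGen.tail ih ⟨a, ha, ?_⟩
    have := hx _ ih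
    simpa [pairRate, this, hbc] using hr

/-- While the arms cannot synchronize, the follower moves under the actions of the leader. -/
lemma PairReaches.follower_move {G : RateKernel S} {π : Policy S} {x : S × S} {s s' t : S}
    (hx : ∀ y, G.PairReaches π x y → y.1 ≠ y.2) (h : G.PairReaches π x (s, t)) {a : Fin 2}
    (ha : a ∈ (π t).support) (hr : 0 < G.rate s a s') : G.PairReaches π x (s', t) := by
  by_cases hs : s' = s
  · rwa [hs]
  refine Relation.ReflTransGen.tail h ⟨a, ha, ?_⟩
  have := hx _ h
  simpa [pairRate, this, hs] using hr

/-- In a unichain model, the leader-and-follower pair can synchronize from every state. -/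
lemma Unichain.exists_pairReaches_eq {G : RateKernel S} (hG : G.Unichain) (π : Policy S)
    (x : S × S) : ∃ y, G.PairReaches π x y ∧ y.1 = y.2 := by
  classical
  by_contra! hx
  obtain ⟨C, ⟨⟨c, hc⟩, hC⟩, hreach⟩ := hG.exists_forall_reaches π
  let π' : Policy S := fun s => if s ∈ C then π s else π c
  let F : Set S := {s | ∀ t ∈ C, G.PairReaches π x (s, t)}
  have hFC : ∀ s ∈ F, s ∉ C := fun s hs hsC => hx _ (hs s hsC) rfl
  obtain ⟨s, hsF, hsC⟩ := hG.inter_nonempty π' (A := F) (B := C)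
    ⟨x.1, fun t ht => PairReaches.leader_move hx .refl (hreach x.2 t ht)⟩ ⟨c, hc⟩
    -- A `π'`-move out of `F` uses an action from `π c`, so it is available to the follower while
    -- the leader is at `c`.
    (fun s hs s' hr => by
      obtain ⟨a, ha, hr⟩ := exists_rate_pos_of_policyRate_pos hr
      simp only [π', if_neg (hFC s hs)] at ha
      exact fun t ht => PairReaches.leader_move hx
        (PairReaches.follower_move hx (hs c hc) ha hr) (hreach c t ht))
    (fun s hs s' hr => by
      refine (hC s hs s').1 (.single ?_)
      simpa [policyRate, π', hs] using hr)
  exact hFC s hsF hsC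

end RateKernel
-- Survival probabilities of a finite killed chain
section Killed

variable {α : Type*} [MeasurableSpace α]

/-- The transition operator of the chain with kernel `κ`, killed in `D`. -/
noncomputable def killedStep (κ : Kernel α α) (D : Set α) (f : α → ℝ≥0∞) : α → ℝ≥0∞ :=
  Dᶜ.indicator fun z => ∫⁻ w, f w ∂κ z

lemma killedStep_mono (κ : Kernel α α) (D : Set α) : Monotone (killedStep κ D) :=
  fun _ _ h _ => Set.indicator_le_indicator (lintegral_mono h)

lemma killedStep_iterate_const_mul [DiscreteMeasurableSpace α] (κ : Kernel α α) (D : Set α)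
    (c : ℝ≥0∞) (n : ℕ) (f : α → ℝ≥0∞) :
    (killedStep κ D)^[n] (fun z => c * f z) = fun z => c * (killedStep κ D)^[n] f z := by
  classical
  induction n generalizing f with
  | zero => rfl
  | succ n ih =>
    rw [Function.iterate_succ_apply, Function.iterate_succ_apply, ← ih]
    congr 1
    ext z
    simp only [killedStep, Set.indicator_apply]
    split_ifs
    · rw [lintegral_const_mul _ .of_discrete]
    · simp

lemma killedStep_one_le (κ : Kernel α α) [IsMarkovKernel κ] (D : Set α) :
    killedStep κ D 1 ≤ 1 := by
  classical
  intro z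
  simp only [killedStep, Set.indicator_apply]
  split_ifs <;> simp

lemma killedStep_iterate_antitone (κ : Kernel α α) [IsMarkovKernel κ] (D : Set α) :
    Antitone fun n => (killedStep κ D)^[n] 1 :=
  (killedStep_mono κ D).antitone_iterate_of_map_le (killedStep_one_le κ D)

lemma killedStep_iterate_le_one (κ : Kernel α α) [IsMarkovKernel κ] (D : Set α) (n : ℕ) :
    (killedStep κ D)^[n] 1 ≤ 1 :=
  killedStep_iterate_antitone κ D n.zero_le

/-- If the chain may be killed soon after a step that it can take, it may be killed soon. -/
lemma killedStep_iterate_succ_lt_one [DiscreteMeasurableSpace α]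
    (κ : Kernel α α) [IsMarkovKernel κ] (D : Set α)
    {z w : α} {n : ℕ} (hzw : κ z {w} ≠ 0) (hw : (killedStep κ D)^[n] 1 w < 1) :
    (killedStep κ D)^[n + 1] 1 z < 1 := by
  rw [Function.iterate_succ_apply']
  refine (Set.indicator_le_self' (fun _ _ => zero_le) z).trans_lt ?_
  have h : ∫⁻ v, (killedStep κ D)^[n] 1 v ∂κ z < ∫⁻ _, 1 ∂κ z := by
    refine lintegral_strict_mono_of_ae_le_of_ae_lt_on (s := {w}) (by fun_prop) ?_
      (.of_forall (killedStep_iterate_le_one κ D n)) hzw (.of_forall ?_)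
    · refine ((lintegral_mono (killedStep_iterate_le_one κ D n)).trans_lt ?_).ne
      simp
    · rintro _ rfl
      exact hw
  simpa using h

/-- A finite chain that may be killed from every state survives `n` steps with probabilities that
have a bounded sum. -/
lemma exists_tsum_killedStep_iterate_le [Finite α] [DiscreteMeasurableSpace α]
    (κ : Kernel α α) [IsMarkovKernel κ] (D : Set α)
    (h : ∀ z, ∃ n, (killedStep κ D)^[n] 1 z < 1) :
    ∃ B : ℕ → ℝ≥0∞, (∀ n z, (killedStep κ D)^[n] 1 z ≤ B n) ∧ ∑' n, B n < ⊤ := by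
  cases isEmpty_or_nonempty α
  · exact ⟨0, fun _ z => isEmptyElim z, by simp⟩
  choose N hN using h
  obtain ⟨M, hM⟩ := (Set.finite_range N).bddAbove
  have hM1 (z : α) : (killedStep κ D)^[M + 1] 1 z < 1 :=
    (killedStep_iterate_antitone κ D ((hM ⟨z, rfl⟩).trans M.le_succ) z).trans_lt (hN z)
  -- The worst starting point gives a uniform survival bound `c < 1` over blocks of `M + 1` steps.
  obtain ⟨z₀, hz₀⟩ := Finite.exists_max fun z => (killedStep κ D)^[M + 1] 1 z
  set c := (killedStep κ D)^[M + 1] 1 z₀ with hc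
  have hpow (m : ℕ) : (killedStep κ D)^[(M + 1) * m] 1 ≤ fun _ => c ^ m := by
    induction m with
    | zero => exact fun _ => le_of_eq (by simp)
    | succ m ih =>
      rw [Nat.mul_succ, Function.iterate_add_apply]
      refine ((killedStep_mono κ D).iterate _
        (show _ ≤ fun z => c * (1 : α → ℝ≥0∞) z from fun z => by simpa using hz₀ z)).trans ?_
      rw [killedStep_iterate_const_mul, pow_succ']
      exact fun z => mul_le_mul_right (ih z) c
  refine ⟨fun n => c ^ (n / (M + 1)), fun n z =>
    (killedStep_iterate_antitone κ D (Nat.mul_div_le n (M + 1)) z).trans (hpow _ z), ?_⟩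
  -- Each power `c ^ m` occurs `M + 1` times, which leaves a geometric series.
  rw [← (Nat.divModEquiv (M + 1)).symm.tsum_eq, ENNReal.tsum_prod']
  have hdiv (m : ℕ) (i : Fin (M + 1)) :
      ((Nat.divModEquiv (M + 1)).symm (m, i)) / (M + 1) = m := by
    have := (Nat.divModEquiv (M + 1)).apply_symm_apply (m, i)
    exact congrArg Prod.fst this
  simp only [hdiv, tsum_fintype, Finset.sum_const, nsmul_eq_mul]
  rw [ENNReal.tsum_mul_left, ENNReal.tsum_geometric]
  refine ENNReal.mul_lt_top (by simp) (ENNReal.inv_lt_top.2 (tsub_pos_of_lt (hM1 z₀)))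

/-- The law of the Markov chain with initial distribution `μ` and kernel `κ`. -/
noncomputable abbrev chainLaw (μ : Measure α) (κ : Kernel α α) [IsMarkovKernel κ] :
    Measure (ℕ → α) :=
  Kernel.trajMeasure (X := fun _ => α) μ
    (fun n => κ.comap (fun h => h ⟨n, Finset.mem_Iic.2 le_rfl⟩) (measurable_pi_apply _))

lemma measurableSet_forall_lt_notMem {D : Set α} (hD : MeasurableSet D) (n : ℕ) :
    MeasurableSet {ω : ℕ → α | ∀ i < n, ω i ∉ D} := by
  simp only [Set.ofPred_forall]
  exact .iInter fun i => .iInter fun _ =>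
    hD.compl.preimage (measurable_pi_apply i)

/-- Markov property at time `n`: averaging over the next state replaces `f` by its `κ`-integral, and
the killing absorbs the condition at time `n`. Iteration pulls a function of the last state back to
time `0`. -/
lemma lintegral_chainLaw_succ (μ : Measure α) [IsProbabilityMeasure μ] (κ : Kernel α α)
    [IsMarkovKernel κ] {D : Set α} (hD : MeasurableSet D) {f : α → ℝ≥0∞} (hf : Measurable f)
    (n : ℕ) :
    ∫⁻ ω, {ω : ℕ → α | ∀ i < n + 1, ω i ∉ D}.indicator (fun ω => f (ω (n + 1))) ω ∂chainLaw μ κ =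
      ∫⁻ ω, {ω : ℕ → α | ∀ i < n, ω i ∉ D}.indicator (fun ω => killedStep κ D f (ω n)) ω
        ∂chainLaw μ κ := by
  classical
  let E : Set (Finset.Iic n → α) := {h | ∀ i, h i ∉ D}
  have hE : MeasurableSet E := by
    simp only [E, Set.ofPred_forall]
    exact .iInter fun i => hD.compl.preimage (measurable_pi_apply i)
  let F : (Finset.Iic n → α) × α → ℝ≥0∞ := (E ×ˢ Set.univ).indicator fun p => f p.2
  have hF : Measurable F := (hf.comp measurable_snd).indicator (hE.prod .univ)
  have hmem (ω : ℕ → α) : Preorder.frestrictLe n ω ∈ E ↔ ∀ i < n + 1, ω i ∉ D := by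
    simp only [E, Set.mem_ofPred_eq, Preorder.frestrictLe_apply, Subtype.forall, Finset.mem_Iic,
      Nat.lt_succ_iff]
  have hm : Measurable fun ω : ℕ → α => (Preorder.frestrictLe (π := fun _ => α) n ω, ω (n + 1)) := by
    fun_prop
  calc _ = ∫⁻ ω, F (Preorder.frestrictLe n ω, ω (n + 1)) ∂chainLaw μ κ := by
        refine lintegral_congr fun ω => ?_
        simp only [F, Set.indicator_apply, Set.mem_prod, Set.mem_univ, and_true, hmem,
          Set.mem_ofPred_eq]
    _ = ∫⁻ p, F p ∂(chainLaw μ κ).map fun ω => (Preorder.frestrictLe n ω, ω (n + 1)) :=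
        (lintegral_map hF hm).symm
    _ = _ := by
        rw [← Kernel.map_frestrictLe_trajMeasure_compProd_eq_map_trajMeasure,
          Measure.lintegral_compProd hF, lintegral_map hF.lintegral_kernel_prod_right' (by fun_prop)]
        refine lintegral_congr fun ω => ?_
        simp only [F, Set.indicator_apply, Set.mem_prod, Set.mem_univ, and_true, hmem,
          Set.mem_ofPred_eq, Kernel.comap_apply, killedStep, Preorder.frestrictLe_apply]
        simp only [Nat.forall_lt_succ_right, Set.mem_compl_iff]
        by_cases h1 : ∀ i < n, ω i ∉ D
        · by_cases h2 : ω n ∈ D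
          · simp [h2]
          · simp only [and_iff_right h1, if_pos h1, h2, not_false_eq_true, if_true]
        · simp only [h1, false_and, if_false, lintegral_zero]

/-- The probability that a chain avoids `D` for `n` steps. -/
lemma chainLaw_forall_lt_notMem [DiscreteMeasurableSpace α] (μ : Measure α)
    [IsProbabilityMeasure μ] (κ : Kernel α α) [IsMarkovKernel κ] (D : Set α) (n : ℕ) :
    chainLaw μ κ {ω | ∀ i < n, ω i ∉ D} = ∫⁻ ω, (killedStep κ D)^[n] 1 (ω 0) ∂chainLaw μ κ := by
  have key (f : α → ℝ≥0∞) :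
      ∫⁻ ω, {ω : ℕ → α | ∀ i < n, ω i ∉ D}.indicator (fun ω => f (ω n)) ω ∂chainLaw μ κ =
        ∫⁻ ω, (killedStep κ D)^[n] f (ω 0) ∂chainLaw μ κ := by
    induction n generalizing f with
    | zero => simp
    | succ n ih =>
      rw [lintegral_chainLaw_succ μ κ .of_discrete .of_discrete, ih, Function.iterate_succ_apply]
  rw [← key, ← lintegral_indicator_one (measurableSet_forall_lt_notMem .of_discrete n)]
  rfl

end Killed

/-! ### Exponential epoch lengths -/

section Exponential

lemma lintegral_ofReal_expMeasure_lt_top {r : ℝ} (hr : 0 < r) :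
    ∫⁻ x, ENNReal.ofReal x ∂expMeasure r < ⊤ := by
  have hpdf : Measurable (gammaPDF 1 r) := (measurable_gammaPDFReal 1 r).ennreal_ofReal
  rw [expMeasure, gammaMeasure, lintegral_withDensity_eq_lintegral_mul _ hpdf
    ENNReal.measurable_ofReal]
  have hint : IntegrableOn (fun x : ℝ => r * (x * Real.exp (-r * x))) (Set.Ioi 0) := by
    have := integrableOn_rpow_mul_exp_neg_mul_rpow (p := 1) (s := 1) (b := r) (by norm_num)
      one_pos hr
    simp only [Real.rpow_one] at this
    exact this.const_mul r
  refine lt_of_le_of_lt ?_ (hint.lintegral_lt_top)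
  rw [← lintegral_indicator measurableSet_Ioi]
  refine lintegral_mono fun x => ?_
  by_cases hx : 0 < x
  · simp only [Pi.mul_apply, gammaPDF_of_nonneg hx.le, Set.indicator_of_mem (Set.mem_Ioi.2 hx)]
    rw [← ENNReal.ofReal_mul (by positivity)]
    exact ENNReal.ofReal_le_ofReal (le_of_eq (by simp; ring))
  · simp [ENNReal.ofReal_of_nonpos (not_lt.1 hx)]

lemma ae_pos_expMeasure {r : ℝ} : ∀ᵐ x ∂expMeasure r, 0 < x := by
  have h : expMeasure r (Set.Iic 0) = 0 := by
    rw [expMeasure, gammaMeasure, withDensity_apply _ measurableSet_Iic,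
      setLIntegral_congr Iio_ae_eq_Iic.symm]
    exact lintegral_gammaPDF_of_nonpos le_rfl
  rw [ae_iff]
  simp only [not_lt]
  exact h

end Exponential
-- The synchronization time along a path
section SyncTime

variable {S : Type*}

/-- The configurations in which the arms are synchronized. -/
def synced (S : Type*) : Set (Config S) := {z | z.follower = z.leader}

/-- The synchronization time is the time of the first decision epoch at which the arms agree. -/
lemma syncTime_eq_ofReal_epochTime {ω : Sample S} (hpos : ∀ j, 0 < ω.2 j) {N : ℕ}
    (hN : ω.1 N ∈ synced S) (hlt : ∀ i < N, ω.1 i ∉ synced S) :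
    syncTime ω = ENNReal.ofReal (epochTime ω N) := by
  have hmono : StrictMono (epochTime ω) := strictMono_nat_of_lt_succ fun n => by
    simp [epochTime, Finset.sum_range_succ, hpos]
  have h0 : epochTime ω 0 = 0 := by simp [epochTime]
  have hTN : 0 ≤ epochTime ω N := h0 ▸ hmono.monotone N.zero_le
  refine le_antisymm (iInf₂_le_of_le (epochTime ω N).toNNReal ?_ le_rfl)
    (le_iInf₂ fun t ht => ?_)
  · have : epochIndex ω (epochTime ω N).toNNReal = N := by
      simp only [epochIndex, Real.coe_toNNReal _ hTN, hmono.le_iff_le]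
      exact csSup_Iic
    rw [configAt, this]
    exact hN
  · rw [← ENNReal.ofReal_coe_nnreal]
    refine ENNReal.ofReal_le_ofReal (not_lt.1 fun hlt' => ?_)
    have hb (k : ℕ) (hk : epochTime ω k ≤ t) : k < N := hmono.lt_iff_lt.1 (hk.trans_lt hlt')
    -- Boundedness by `N` matters: the supremum of an unbounded set of naturals is `0` by default.
    have hmem : epochIndex ω t ∈ {k | epochTime ω k ≤ t} :=
      Nat.sSup_mem ⟨0, show epochTime ω 0 ≤ t by rw [h0]; exact t.2⟩ ⟨N, fun k hk => (hb k hk).le⟩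
    exact hlt _ (hb _ hmem) ht

/-- The synchronization time is the sum of the times between epochs until the arms agree. -/
lemma syncTime_eq_tsum {ω : Sample S} (hpos : ∀ j, 0 < ω.2 j) (h : ∃ n, ω.1 n ∈ synced S) :
    syncTime ω = ∑' j, {x : ℕ → Config S | ∀ i < j + 1, x i ∉ synced S}.indicator 1 ω.1 *
      ENNReal.ofReal (ω.2 j) := by
  classical
  rw [syncTime_eq_ofReal_epochTime hpos (Nat.find_spec h) fun i hi => Nat.find_min h hi,
    tsum_eq_sum (s := Finset.range (Nat.find h)), epochTime,
    ENNReal.ofReal_sum_of_nonneg fun j _ => (hpos j).le]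
  -- The length between epochs `j` and `j + 1` counts exactly if the arms disagree at epochs `0, …,
  -- j`.
  · refine Finset.sum_congr rfl fun j hj => ?_
    rw [Set.indicator_of_mem, Pi.one_apply, one_mul]
    exact fun i hi => Nat.find_min h (by have := Finset.mem_range.1 hj; omega)
  · intro j hj
    rw [Set.indicator_of_notMem, zero_mul]
    intro hj'
    exact hj' _ (by have := Finset.mem_range.not.1 hj; omega) (Nat.find_spec h)

end SyncTime

variable {S : Type*} [Fintype S] [DecidableEq S]

/-! ### Expected number of epochs and expected time -/

lemma RateKernel.mem_support_pairStep (G : RateKernel S) {Λ : ℝ} (hΛ : G.IsUniformizationRate Λ)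
    {x y : S × S} {a : Fin 2} (h : 0 < G.pairRate x a y) : y ∈ (G.pairStep hΛ x a).support := by
  rw [PMF.mem_support_iff, pairStep, PMF.ofFintype_apply, ne_eq, ENNReal.ofReal_eq_zero, not_le]
  have := div_pos h hΛ.pos
  split_ifs <;> linarith

lemma mem_support_epochStep (G : RateKernel S) {Λ : ℝ} (hΛ : G.IsUniformizationRate Λ)
    {π : Policy S} {x y : S × S} {a b : Fin 2} (h : y ∈ (G.pairStep hΛ x a).support)
    (hb : b ∈ (π y.2).support) : (y, b) ∈ (epochStep G hΛ π (x, a)).support := by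
  rw [epochStep, PMF.mem_support_bind_iff]
  refine ⟨y, h, ?_⟩
  rw [chooseAction, PMF.mem_support_map_iff]
  exact ⟨b, hb, rfl⟩

variable [MeasurableSpace S] [MeasurableSingletonClass S]

lemma epochKernel_singleton_ne_zero (G : RateKernel S) {Λ : ℝ} (hΛ : G.IsUniformizationRate Λ)
    {π : Policy S} {z w : Config S} (h : w ∈ (epochStep G hΛ π z).support) :
    epochKernel G hΛ π z {w} ≠ 0 := by
  have : epochKernel G hΛ π z {w} = epochStep G hΛ π z w :=
    PMF.toMeasure_apply_singleton _ _ (measurableSet_singleton w)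
  rwa [this]

/-- In a unichain model, the leader-and-follower system may synchronize from every configuration. -/
lemma RateKernel.Unichain.exists_killedStep_iterate_lt_one {G : RateKernel S} (hG : G.Unichain)
    {Λ : ℝ} (hΛ : G.IsUniformizationRate Λ) (π : Policy S) (z : Config S) :
    ∃ n, (killedStep (epochKernel G hΛ π) (synced S))^[n] 1 z < 1 := by
  have hsync (z : Config S) (hz : z ∈ synced S) :
      ∃ n, (killedStep (epochKernel G hΛ π) (synced S))^[n] 1 z < 1 :=
    ⟨1, by simp [killedStep, hz]⟩
  have hpair (x : S × S) : ∃ a ∈ (π x.2).support,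
      ∃ n, (killedStep (epochKernel G hΛ π) (synced S))^[n] 1 (x, a) < 1 := by
    obtain ⟨y, hxy, hy⟩ := hG.exists_pairReaches_eq π x
    induction hxy using Relation.ReflTransGen.head_induction_on with
    | refl =>
      obtain ⟨a, ha⟩ := (π y.2).support_nonempty
      exact ⟨a, ha, hsync _ hy⟩
    | head h _ ih =>
      obtain ⟨a, ha, hr⟩ := h
      obtain ⟨b, hb, n, hn⟩ := ih
      exact ⟨a, ha, n + 1, killedStep_iterate_succ_lt_one _ _ (epochKernel_singleton_ne_zero G hΛ
        (mem_support_epochStep G hΛ (G.mem_support_pairStep hΛ hr) hb)) hn⟩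
  -- The action held in `z` may not lead towards synchronization, so one step is spent to have a new
  -- one drawn.
  obtain ⟨y, hy⟩ := (G.pairStep hΛ z.1 z.2).support_nonempty
  obtain ⟨b, hb, n, hn⟩ := hpair y
  exact ⟨n + 1, killedStep_iterate_succ_lt_one _ _ (epochKernel_singleton_ne_zero G hΛ
    (mem_support_epochStep G hΛ hy hb)) hn⟩

/-- The expected number of decision epochs before synchronization is finite. -/
lemma RateKernel.Unichain.tsum_epochLaw_lt_top {G : RateKernel S} (hG : G.Unichain)
    {Λ : ℝ} (hΛ : G.IsUniformizationRate Λ) (π : Policy S) (s s' : S) :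
    ∑' n, epochLaw G hΛ π s s' {x | ∀ i < n, x i ∉ synced S} < ⊤ := by
  obtain ⟨B, hB, hsum⟩ := exists_tsum_killedStep_iterate_le (epochKernel G hΛ π) (synced S)
    (hG.exists_killedStep_iterate_lt_one hΛ π)
  refine (ENNReal.tsum_le_tsum fun n => ?_).trans_lt hsum
  refine (chainLaw_forall_lt_notMem (chooseAction π (s, s')).toMeasure
    (epochKernel G hΛ π) (synced S) n).trans_le ?_
  refine (lintegral_mono fun x : ℕ → Config S => hB n (x 0)).trans ?_
  simp

instance (G : RateKernel S) {Λ : ℝ} (hΛ : G.IsUniformizationRate Λ) (π : Policy S) (s s' : S) :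
    IsProbabilityMeasure (epochLaw G hΛ π s s') :=
  inferInstanceAs (IsProbabilityMeasure (chainLaw _ _))

lemma RateKernel.Unichain.ae_exists_synced {G : RateKernel S} (hG : G.Unichain)
    {Λ : ℝ} (hΛ : G.IsUniformizationRate Λ) (π : Policy S) (s s' : S) :
    ∀ᵐ x ∂epochLaw G hΛ π s s', ∃ n, x n ∈ synced S := by
  rw [ae_iff]
  -- Never synchronizing is contained in every survival event, and the summable probabilities of
  -- these tend to `0`.
  refine le_antisymm (ge_of_tendsto' (ENNReal.tendsto_atTop_zero_of_tsum_ne_top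
    (hG.tsum_epochLaw_lt_top hΛ π s s').ne) fun n => measure_mono fun x hx i _ hi => ?_) zero_le
  exact hx ⟨i, hi⟩

end RestlessBandit

theorem mainTheorem3 {S : Type*} [Fintype S] [DecidableEq S] [MeasurableSpace S]
    [MeasurableSingletonClass S] (G : RestlessBandit.RateKernel S) (hG : G.Unichain)
    (π : RestlessBandit.Policy S) (Λ : ℝ) (hΛ : G.IsUniformizationRate Λ) (s sHat : S) :
    AEMeasurable RestlessBandit.syncTime (RestlessBandit.leaderFollowerLaw G hΛ π s sHat) ∧
      ∫⁻ ω, RestlessBandit.syncTime ω ∂(RestlessBandit.leaderFollowerLaw G hΛ π s sHat) < ⊤ := by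
  open RestlessBandit in
  have : IsProbabilityMeasure (expMeasure Λ) := isProbabilityMeasure_expMeasure hΛ.pos
  let E (j : ℕ) : Set (ℕ → Config S) := {x | ∀ i < j + 1, x i ∉ synced S}
  have hE (j : ℕ) : MeasurableSet (E j) := measurableSet_forall_lt_notMem .of_discrete _
  have hmeas (j : ℕ) : Measurable fun ω : Sample S =>
      (E j).indicator 1 ω.1 * ENNReal.ofReal (ω.2 j) := by
    have h1 : Measurable ((E j).indicator (1 : (ℕ → Config S) → ℝ≥0∞)) :=
      measurable_one.indicator (hE j)
    fun_prop
  have hpos : ∀ᵐ y ∂Measure.infinitePi fun _ : ℕ => expMeasure Λ, ∀ j, 0 < y j :=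
    ae_all_iff.2 fun j => (measurePreserving_eval_infinitePi (fun _ : ℕ => expMeasure Λ)
      j).quasiMeasurePreserving.ae ae_pos_expMeasure
  -- The infimum over uncountably many times agrees almost surely with a measurable series.
  have hae : syncTime =ᵐ[leaderFollowerLaw G hΛ π s sHat] fun ω : Sample S =>
      ∑' j, (E j).indicator 1 ω.1 * ENNReal.ofReal (ω.2 j) := by
    filter_upwards [Measure.quasiMeasurePreserving_fst.ae (hG.ae_exists_synced hΛ π s sHat),
      Measure.quasiMeasurePreserving_snd.ae hpos] with ω h1 h2
    exact syncTime_eq_tsum h2 h1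
  refine ⟨⟨_, Measurable.tsum hmeas, hae⟩, ?_⟩
  rw [lintegral_congr_ae hae, lintegral_tsum fun j => (hmeas j).aemeasurable]
  have hterm (j : ℕ) : ∫⁻ ω, (E j).indicator 1 ω.1 * ENNReal.ofReal (ω.2 j)
      ∂leaderFollowerLaw G hΛ π s sHat =
      epochLaw G hΛ π s sHat (E j) * ∫⁻ x, ENNReal.ofReal x ∂expMeasure Λ := by
    rw [leaderFollowerLaw, lintegral_prod_mul (f := (E j).indicator 1)
      (g := fun y : ℕ → ℝ => ENNReal.ofReal (y j)) (measurable_one.indicator (hE j)).aemeasurable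
      (ENNReal.measurable_ofReal.comp (measurable_pi_apply j)).aemeasurable, lintegral_indicator_one (hE j),
      ← (measurePreserving_eval_infinitePi (fun _ : ℕ => expMeasure Λ) j).lintegral_comp
        ENNReal.measurable_ofReal]
  simp only [hterm]
  rw [ENNReal.tsum_mul_right]
  -- `E j` is the survival event with index `j + 1`, so the sum over `j` is bounded by the full sum
  -- over `n`.
  refine ENNReal.mul_lt_top ((ENNReal.tsum_comp_le_tsum_of_injective (add_left_injective 1)
    fun n => epochLaw G hΛ π s sHat {x | ∀ i < n, x i ∉ synced S}).trans_lt
      (hG.tsum_epochLaw_lt_top hΛ π s sHat)) (lintegral_ofReal_expMeasure_lt_top hΛ.pos)
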